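/- A generalized composition of an integer $n\ge 1$ is a word $v_1^{w_1}v_2^{w_2}\cdots v_k^{w_k}$ (i.e. a finite sequence of pairs $(v_i,w_i)$, of any length $k\ge 1$) with $v_i,w_i\in\mathbb{Z}_{>0}$ and $\sum_{i=1}^k v_iw_i=n$; its greatest common divisor is $\gcd(v_1,\dots,v_k)$ (which is $v_1$ if $k=1$). Let $c_n$ be the number of generalized compositions of $n$, and let $d_n$ be the number of those with greatest common divisor $1$. Let $\sigma(z)=\sum_{n\ge 1}\frac{z^n}{1-z^n}$. Then the equation $\sigma(z)=1$ has a unique real root $\rho$ in $[0,1]$, this root satisfies $|\rho-0.406|<0.0005$, the function $\sigma$ is differentiable at $\rho$, and, as $n\to\infty$, $$d_n\sim\frac{1}{\rho\,\sigma'(\rho)}\,\rho^{-n},\qquad c_n\sim\frac{1}{\rho\,\sigma'(\rho)}\,\rho^{-n},\qquad \frac{d_n}{c_n}\to 1,$$ where $a_n\sim b_n$ means $\lim_{n\to\infty}a_n/b_n=1$. -/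

import Mathlib

/-- The number `∑ i, v i * w i` of which the word `v₁^{w₁} ⋯ v_k^{w_k}`, given as the list of the
pairs `(v i, w i)`, is a generalized composition. -/
def wordSum (l : List (ℕ × ℕ)) : ℕ :=
  (l.map fun p => p.1 * p.2).sum

/-- The greatest common divisor `gcd (v₁, …, v_k)` of a word; it is `v₁` when `k = 1`. -/
def wordGcd (l : List (ℕ × ℕ)) : ℕ :=
  (l.map Prod.fst).foldr Nat.gcd 0

/-- The generalized compositions of `n`: words `v₁^{w₁} ⋯ v_k^{w_k}` of arbitrary length `k` with
all `v i, w i > 0` and `∑ i, v i * w i = n`. -/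
def genCompositions (n : ℕ) : Set (List (ℕ × ℕ)) :=
  {l | (∀ p ∈ l, 0 < p.1 ∧ 0 < p.2) ∧ wordSum l = n}

/-- The generalized compositions of `n` with greatest common divisor `1`. -/
def primGenCompositions (n : ℕ) : Set (List (ℕ × ℕ)) :=
  {l | l ∈ genCompositions n ∧ wordGcd l = 1}

/-- There are finitely many generalized compositions of `n`, so that `Set.ncard` below is their
true number. -/
theorem genCompositions_finite (n : ℕ) : (genCompositions n).Finite := by
  have key : ∀ l : List (ℕ × ℕ), (∀ p ∈ l, 0 < p.1 ∧ 0 < p.2) →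
      l.length ≤ wordSum l ∧ ∀ p ∈ l, p.1 ≤ wordSum l ∧ p.2 ≤ wordSum l := by
    intro l
    induction l with
    | nil => intro _; simp [wordSum]
    | cons q t ih =>
      intro h
      obtain ⟨h1, h2⟩ := ih fun p hp => h p (List.mem_cons_of_mem _ hp)
      obtain ⟨ha, hb⟩ := h q List.mem_cons_self
      have hs : wordSum (q :: t) = q.1 * q.2 + wordSum t := by simp [wordSum]
      have e1 : q.1 ≤ q.1 * q.2 := Nat.le_mul_of_pos_right _ hb
      have e2 : q.2 ≤ q.1 * q.2 := Nat.le_mul_of_pos_left _ ha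
      refine ⟨by rw [hs, List.length_cons]; omega, fun p hp => ?_⟩
      rcases List.mem_cons.1 hp with rfl | hp
      · omega
      · have := h2 p hp
        omega
  refine ((List.finite_length_le (Fin (n + 1) × Fin (n + 1)) n).image
    (List.map fun p => ((p.1 : ℕ), (p.2 : ℕ)))).subset ?_
  rintro l ⟨hl, hn⟩
  obtain ⟨h1, h2⟩ := key l hl
  rw [hn] at h1 h2
  refine ⟨l.map fun p => (Fin.ofNat (n + 1) p.1, Fin.ofNat (n + 1) p.2), by simpa using h1, ?_⟩
  rw [List.map_map]
  conv_rhs => rw [← List.map_id l]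
  refine List.map_congr_left fun p hp => ?_
  obtain ⟨ha, hb⟩ := h2 p hp
  simp [Fin.ofNat, Nat.mod_eq_of_lt (Nat.lt_succ_of_le ha), Nat.mod_eq_of_lt (Nat.lt_succ_of_le hb)]

/-- `c_n`, the number of generalized compositions of `n`. -/
noncomputable def cSeq (n : ℕ) : ℕ := (genCompositions n).ncard

/-- `d_n`, the number of generalized compositions of `n` with greatest common divisor `1`. -/
noncomputable def dSeq (n : ℕ) : ℕ := (primGenCompositions n).ncard

/-- `σ(z) = ∑_{n ≥ 1} z^n / (1 - z^n)`. The sum is `0` where the series diverges, and `σ(1) = 0`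
by the convention `1 / 0 = 0`; hence `σ(z) = 1` on `[0, 1]` means that `z < 1` and that the series
converges to `1`. -/
noncomputable def lambertSigma (z : ℝ) : ℝ := ∑' n : ℕ, z ^ (n + 1) / (1 - z ^ (n + 1))

/-! Write τ(k) for the number of divisors of k. A first letter v^w of weight k = vw is a
factorisation of k, so c_n = ∑ τ(k) c_{n-k} for n > 0. Expanding the Lambert series gives σ(z) = ∑
τ(k) z^k; hence σ(ρ) = 1 makes p_k = τ(k) ρ^k a probability distribution with renewal sequence u_n =
c_n ρ^n. By `renewal_tendsto`, u_n tends to the reciprocal of the mean ∑ k p_k = ρ σ'(ρ).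

The renewal theorem is proved by compactness. The recursion writes an extremal cluster point of u as
a p-average of cluster points, so all of these coincide with it (`renewal_extremal_clusterPt`); a
conserved sum (`renewal_sum_tail`) then fixes its value.

Dividing a word by its gcd g ≥ 2 leaves a word of n/g, so the nonprimitive words number at most ∑
c_{n/g} ≤ n ρ^{-n/2}, which is negligible. -/

open Filter Topology Finset

/-! ### The renewal theorem -/

/-- Summation by parts: the tails `1 - ∑ j ≤ k, p j` of a probability sequence sum to its mean. -/
theorem hasSum_tail_of_hasSum_one {p : ℕ → ℝ} (hp : ∀ k, 0 ≤ p k) (hs : HasSum p 1)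
    (hm : Summable fun k : ℕ => (k : ℝ) * p k) :
    HasSum (fun k => 1 - ∑ j ∈ range (k + 1), p j) (∑' k : ℕ, (k : ℝ) * p k) := by
  -- Both sides sum p k over the pairs j < k: rows give the mean, columns give the tails.
  let f : ℕ × ℕ → ℝ := fun q => if q.2 < q.1 then p q.1 else 0
  have hrow : ∀ k, HasSum (fun j => f (k, j)) ((k : ℝ) * p k) := by
    intro k
    have h : HasSum (fun j => f (k, j)) (∑ j ∈ range k, f (k, j)) :=
      hasSum_sum_of_ne_finset_zero fun j hj => by
        simp only [mem_range, not_lt] at hj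
        simp [f, hj]
    convert h using 1
    rw [sum_congr rfl (g := fun _ => p k) (fun j hj => by simp [f, mem_range.1 hj])]
    simp
  have hf0 : 0 ≤ f := fun q => by
    by_cases h : q.2 < q.1 <;> simp [f, h, hp]
  have hf : Summable f := (summable_prod_of_nonneg hf0).2
    ⟨fun k => (hrow k).summable, by simpa only [(hrow _).tsum_eq] using hm⟩
  have hcol : ∀ j, HasSum (fun k => f (k, j)) (1 - ∑ i ∈ range (j + 1), p i) := by
    intro j
    have h := (hasSum_nat_add_iff' (j + 1)).2 hs
    have h2 : HasSum (fun k => f (k + (j + 1), j)) (1 - ∑ i ∈ range (j + 1), p i) := by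
      refine h.congr_fun fun k => ?_
      have : j < k + (j + 1) := by omega
      simp [f, this]
    have h3 := (hasSum_nat_add_iff (f := fun k => f (k, j)) (j + 1)).1 h2
    rwa [sum_eq_zero (s := range (j + 1)) (f := fun k => f (k, j)), add_zero] at h3
    intro i hi
    have : ¬ j < i := by have := mem_range.1 hi; omega
    simp [f, this]
  have hval : ∑' q, f q = ∑' k : ℕ, (k : ℝ) * p k := by
    rw [← (hf.hasSum.prod_fiberwise hrow).tsum_eq]
  rw [← hval]
  have hswap : HasSum (f ∘ Prod.swap) (∑' q, f q) :=
    (Equiv.prodComm ℕ ℕ).hasSum_iff.2 hf.hasSum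
  exact hswap.prod_fiberwise hcol

section Renewal

variable {p u : ℕ → ℝ}

theorem renewal_nonneg
    (hp0 : p 0 = 0) (hp : ∀ k, 0 < k → 0 < p k) (hu0 : u 0 = 1)
    (hu : ∀ n, 0 < n → u n = ∑ q ∈ antidiagonal n, p q.1 * u q.2)
    (n : ℕ) : 0 ≤ u n := by
  induction n using Nat.strong_induction_on with
  | _ n ih =>
    rcases Nat.eq_zero_or_pos n with rfl | hn
    · simp [hu0]
    rw [hu n hn]
    refine sum_nonneg fun q hq => ?_
    rw [HasAntidiagonal.mem_antidiagonal] at hq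
    rcases Nat.eq_zero_or_pos q.1 with h | h
    · simp [h, hp0]
    · exact mul_nonneg (hp _ h).le (ih _ (by omega))

/-- Probabilistically, this splits according to the last renewal up to time n. In the induction,
expanding u (n + 1) by the recursion adds p (k + 1) to the tail after k + 1, which turns it into the
tail after k. -/
theorem renewal_sum_tail
    (hp0 : p 0 = 0) (hu0 : u 0 = 1)
    (hu : ∀ n, 0 < n → u n = ∑ q ∈ antidiagonal n, p q.1 * u q.2)
    (n : ℕ) :
    ∑ q ∈ antidiagonal n, (1 - ∑ j ∈ range (q.1 + 1), p j) * u q.2 = 1 := by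
  induction n with
  | zero => simp [hp0, hu0]
  | succ n ih =>
    have h := hu (n + 1) n.succ_pos
    rw [Nat.sum_antidiagonal_succ] at h ⊢
    simp only [hp0, zero_mul, zero_add, range_one, sum_singleton, sub_zero, one_mul] at h ⊢
    rw [h, ← sum_add_distrib]
    refine Eq.trans ?_ ih
    refine sum_congr rfl fun q _ => ?_
    rw [sum_range_succ _ (q.1 + 1)]
    ring

/-- Since p 0 = 0, u n itself is one of the nonnegative terms of the sum in `renewal_sum_tail`. -/
theorem renewal_le_one
    (hp0 : p 0 = 0) (hp : ∀ k, 0 < k → 0 < p k) (hs : HasSum p 1) (hu0 : u 0 = 1)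
    (hu : ∀ n, 0 < n → u n = ∑ q ∈ antidiagonal n, p q.1 * u q.2)
    (n : ℕ) : u n ≤ 1 := by
  have hpn : ∀ k, 0 ≤ p k := fun k =>
    (Nat.eq_zero_or_pos k).elim (fun h => by simp [h, hp0]) fun h => (hp k h).le
  rw [← renewal_sum_tail hp0 hu0 hu n]
  have := single_le_sum (f := fun q : ℕ × ℕ => (1 - ∑ j ∈ range (q.1 + 1), p j) * u q.2)
    (s := antidiagonal n) (fun q _ => mul_nonneg
      (sub_nonneg.2 (sum_le_hasSum _ (fun i _ => hpn i) hs)) (renewal_nonneg hp0 hp hu0 hu _))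
    (show (0, n) ∈ antidiagonal n by simp)
  simpa [hp0] using this

/-- Dominated convergence for convolutions with a summable sequence. -/
theorem tendsto_sum_antidiagonal_mul {a u b : ℕ → ℝ} (ha : Summable a) (ha0 : ∀ k, 0 ≤ a k)
    (hu : ∀ n, |u n| ≤ 1) {F : Filter ℕ} (hF : F ≤ atTop)
    (hb : ∀ k, Tendsto (fun n => u (n - k)) F (𝓝 (b k))) :
    Tendsto (fun n => ∑ q ∈ antidiagonal n, a q.1 * u q.2) F (𝓝 (∑' k, a k * b k)) := by
  have key : Tendsto (fun n => ∑' k, if k ≤ n then a k * u (n - k) else 0) F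
      (𝓝 (∑' k, a k * b k)) := by
    refine tendsto_tsum_of_dominated_convergence ha (fun k => ?_) (.of_forall fun n k => ?_)
    · refine ((hb k).const_mul (a k)).congr' ?_
      filter_upwards [hF (eventually_ge_atTop k)] with n hn
      rw [if_pos hn]
    · split_ifs
      · rw [Real.norm_eq_abs, abs_mul, abs_of_nonneg (ha0 k)]
        exact mul_le_of_le_one_right (ha0 k) (hu _)
      · simpa using ha0 k
  refine key.congr fun n => ?_
  rw [tsum_eq_sum (s := range (n + 1)), Nat.sum_antidiagonal_eq_sum_range_succ fun i j => a i * u j]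
  · exact sum_congr rfl fun k hk => if_pos (by simpa [Nat.lt_succ_iff] using hk)
  · intro k hk
    exact if_neg (by simpa [Nat.lt_succ_iff] using hk)

/-- An extremal cluster point of a renewal sequence is the reciprocal of the mean; `s` is the sign
`1` for the largest cluster point and `-1` for the smallest one. -/
theorem renewal_extremal_clusterPt
    (hp0 : p 0 = 0) (hp : ∀ k, 0 < k → 0 < p k) (hs : HasSum p 1) (hu0 : u 0 = 1)
    (hu : ∀ n, 0 < n → u n = ∑ q ∈ antidiagonal n, p q.1 * u q.2)
    (hm : Summable fun k : ℕ => (k : ℝ) * p k) {l s : ℝ}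
    (hs0 : s ≠ 0) (hl : MapClusterPt l atTop u)
    (hmax : ∀ a, MapClusterPt a atTop u → s * a ≤ s * l) :
    l * ∑' k : ℕ, (k : ℝ) * p k = 1 := by
  have hpn : ∀ k, 0 ≤ p k := fun k =>
    (Nat.eq_zero_or_pos k).elim (fun h => by simp [h, hp0]) fun h => (hp k h).le
  have hun := renewal_nonneg hp0 hp hu0 hu
  have hu1 := renewal_le_one hp0 hp hs hu0 hu
  have hua : ∀ n, |u n| ≤ 1 := fun n => by rw [abs_of_nonneg (hun n)]; exact hu1 n
  -- Along an ultrafilter all shifts of u converge at once, by compactness of [0, 1]; no diagonal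
  -- subsequence is needed.
  obtain ⟨F, hF, hFl⟩ := mapClusterPt_iff_ultrafilter.1 hl
  have hshift : ∀ k : ℕ, Tendsto (fun n => n - k) (F : Filter ℕ) atTop := fun k =>
    (tendsto_sub_atTop_nat k).mono_left hF
  have hb : ∀ k : ℕ, ∃ b, Tendsto (fun n => u (n - k)) F (𝓝 b) := by
    intro k
    obtain ⟨b, -, hb⟩ := (isCompact_Icc (a := (0 : ℝ)) (b := 1)).ultrafilter_le_nhds
      (F.map fun n => u (n - k)) (by
        simp only [le_principal_iff]
        exact Filter.univ_mem' (f := (F : Filter ℕ)) fun n => ⟨hun (n - k), hu1 (n - k)⟩)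
    exact ⟨b, hb⟩
  choose b hb using hb
  have hbc : ∀ k, MapClusterPt (b k) atTop u := fun k =>
    (hb k).mapClusterPt.of_comp (hshift k)
  have hsum := tendsto_sum_antidiagonal_mul hs.summable hpn hua hF hb
  have hl_eq : l = ∑' k, p k * b k := by
    refine tendsto_nhds_unique hFl (hsum.congr' ?_)
    filter_upwards [hF (eventually_gt_atTop 0)] with n hn using (hu n hn).symm
  have hbb : ∀ k, |b k| ≤ 1 := fun k =>
    le_of_tendsto (hb k).abs (.of_forall fun n => hua _)
  have hsb : Summable fun k => p k * b k := by
    refine Summable.of_norm_bounded hs.summable fun k => ?_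
    rw [Real.norm_eq_abs, abs_mul, abs_of_nonneg (hpn k)]
    exact mul_le_of_le_one_right (hpn k) (hbb k)
  -- By extremality these terms are nonnegative, so a zero sum makes each of them vanish.
  have hzero : HasSum (fun k => p k * (s * l - s * b k)) 0 := by
    have h := ((hs.mul_right l).sub (hl_eq ▸ hsb.hasSum)).mul_left s
    rw [one_mul, sub_self, mul_zero] at h
    exact h.congr_fun fun k => by ring
  have hz := (hasSum_zero_iff_of_nonneg fun k =>
    mul_nonneg (hpn k) (sub_nonneg.2 (hmax _ (hbc k)))).1 hzero
  have hbl : ∀ k, b k = l := by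
    intro k
    rcases Nat.eq_zero_or_pos k with rfl | hk
    · exact tendsto_nhds_unique (hb 0) hFl
    have h := congrFun hz k
    simp only [Pi.zero_apply, mul_eq_zero, (hp k hk).ne', false_or, ← mul_sub, hs0] at h
    linarith
  -- With every shift tending to l, the identity of `renewal_sum_tail` passes to the limit as mean *
  -- l = 1.
  have htail := hasSum_tail_of_hasSum_one hpn hs hm
  have h := tendsto_sum_antidiagonal_mul htail.summable
    (fun k => sub_nonneg.2 (sum_le_hasSum _ (fun i _ => hpn i) hs)) hua hF hb
  simp only [renewal_sum_tail hp0 hu0 hu, hbl, tsum_mul_right, htail.tsum_eq] at h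
  rw [mul_comm]
  exact tendsto_nhds_unique h tendsto_const_nhds

/-- The renewal theorem for a step distribution with finite mean charging every positive integer. -/
theorem renewal_tendsto
    (hp0 : p 0 = 0) (hp : ∀ k, 0 < k → 0 < p k) (hs : HasSum p 1) (hu0 : u 0 = 1)
    (hu : ∀ n, 0 < n → u n = ∑ q ∈ antidiagonal n, p q.1 * u q.2)
    (hm : Summable fun k : ℕ => (k : ℝ) * p k) :
    Tendsto u atTop (𝓝 (1 / ∑' k : ℕ, (k : ℝ) * p k)) := by
  have hmem : ∀ n, u n ∈ Set.Icc (0 : ℝ) 1 := fun n =>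
    ⟨renewal_nonneg hp0 hp hu0 hu n, renewal_le_one hp0 hp hs hu0 hu n⟩
  let K : Set ℝ := {a | MapClusterPt a atTop u}
  have hKc : IsClosed K := isClosed_setOfPred_clusterPt
  have hKI : K ⊆ Set.Icc 0 1 := fun a ha =>
    isClosed_Icc.mem_of_mapClusterPt ha (.of_forall hmem)
  have hK : IsCompact K := isCompact_Icc.of_isClosed_subset hKc hKI
  have hKn : K.Nonempty := by
    obtain ⟨a, -, ha⟩ := (isCompact_Icc (a := (0 : ℝ)) (b := 1)).exists_mapClusterPt
      (f := atTop) (u := u) (le_principal_iff.2 (Filter.univ_mem' (f := atTop) hmem))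
    exact ⟨a, ha⟩
  obtain ⟨M, hM, hMmax⟩ := hK.exists_isGreatest hKn
  obtain ⟨m, hm', hmmin⟩ := hK.exists_isLeast hKn
  have h1 := renewal_extremal_clusterPt hp0 hp hs hu0 hu hm one_ne_zero hM
    fun a ha => by simpa using hMmax ha
  have h2 := renewal_extremal_clusterPt hp0 hp hs hu0 hu hm (neg_ne_zero.2 one_ne_zero) hm'
    fun a ha => by simpa using hmmin ha
  have e1 := eq_one_div_of_mul_eq_one_left h1
  have e2 := eq_one_div_of_mul_eq_one_left h2
  refine isCompact_Icc.tendsto_nhds_of_unique_mapClusterPt (.of_forall hmem) fun a _ ha => ?_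
  exact le_antisymm (e1 ▸ hMmax ha) (e2 ▸ hmmin ha)

end Renewal

/-! ### Recursion for the number of words -/

theorem wordSum_cons (p : ℕ × ℕ) (l : List (ℕ × ℕ)) :
    wordSum (p :: l) = p.1 * p.2 + wordSum l := by
  simp [wordSum]

theorem wordGcd_cons (p : ℕ × ℕ) (l : List (ℕ × ℕ)) :
    wordGcd (p :: l) = Nat.gcd p.1 (wordGcd l) := by
  simp [wordGcd]

theorem cons_mem_genCompositions {p : ℕ × ℕ} {l : List (ℕ × ℕ)} {n : ℕ} :
    p :: l ∈ genCompositions n ↔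
      (0 < p.1 ∧ 0 < p.2) ∧ (∀ q ∈ l, 0 < q.1 ∧ 0 < q.2) ∧ p.1 * p.2 + wordSum l = n := by
  simp only [genCompositions, Set.mem_ofPred_eq, List.forall_mem_cons, wordSum_cons, and_assoc]

theorem cSeq_zero : cSeq 0 = 1 := by
  have : genCompositions 0 = {[]} := by
    ext l
    cases l with
    | nil => simp [genCompositions, wordSum]
    | cons p l =>
      simp only [cons_mem_genCompositions, Set.mem_singleton_iff, reduceCtorEq, iff_false]
      rintro ⟨⟨h1, h2⟩, -, h⟩
      have := Nat.mul_pos h1 h2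
      omega
  rw [cSeq, this, Set.ncard_singleton]

/-- Splitting off the first letter of a word. -/
theorem cSeq_eq_sum_antidiagonal {n : ℕ} (hn : 0 < n) :
    cSeq n = ∑ q ∈ antidiagonal n, q.1.divisors.card * cSeq q.2 := by
  let G : ℕ → Finset (List (ℕ × ℕ)) := fun m => (genCompositions_finite m).toFinset
  have hG : ∀ m, cSeq m = (G m).card := fun m => Set.ncard_eq_toFinset_card _ _
  have hmem : ∀ {m l}, l ∈ G m ↔ l ∈ genCompositions m := by simp [G]
  calc cSeq n = (G n).card := hG n
    _ = ((antidiagonal n).sigma fun q => q.1.divisorsAntidiagonal ×ˢ G q.2).card := by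
      symm
      refine card_bij (fun x _ => x.2.1 :: x.2.2) ?_ ?_ ?_
      · rintro ⟨⟨a, b⟩, p, l⟩ h
        simp only [mem_sigma, HasAntidiagonal.mem_antidiagonal, mem_product, hmem,
          Nat.mem_divisorsAntidiagonal] at h
        obtain ⟨rfl, ⟨rfl, ha⟩, hl, rfl⟩ := h
        rw [hmem, cons_mem_genCompositions]
        exact ⟨⟨Nat.pos_of_ne_zero (left_ne_zero_of_mul ha),
          Nat.pos_of_ne_zero (right_ne_zero_of_mul ha)⟩, hl, rfl⟩
      · rintro ⟨⟨a, b⟩, p, l⟩ h ⟨⟨a', b'⟩, p', l'⟩ h' heq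
        simp only [mem_sigma, HasAntidiagonal.mem_antidiagonal, mem_product, hmem,
          Nat.mem_divisorsAntidiagonal] at h h'
        obtain ⟨rfl, rfl⟩ := List.cons.inj heq
        obtain ⟨-, ⟨rfl, -⟩, -, rfl⟩ := h
        obtain ⟨-, ⟨rfl, -⟩, -, rfl⟩ := h'
        rfl
      · intro l hl
        rw [hmem] at hl
        cases l with
        | nil =>
          obtain ⟨-, rfl⟩ := hl
          simp [wordSum] at hn
        | cons p l =>
          obtain ⟨⟨h1, h2⟩, hl, hs⟩ := cons_mem_genCompositions.1 hl
          refine ⟨⟨(p.1 * p.2, wordSum l), p, l⟩, ?_, rfl⟩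
          simp only [mem_sigma, HasAntidiagonal.mem_antidiagonal, mem_product, hmem,
            Nat.mem_divisorsAntidiagonal]
          exact ⟨hs, ⟨trivial, (Nat.mul_pos h1 h2).ne'⟩, hl, rfl⟩
    _ = _ := by
      rw [card_sigma]
      refine sum_congr rfl fun q _ => ?_
      rw [card_product, hG, ← Nat.map_div_right_divisors, card_map]

/-! ### Words with nontrivial gcd -/

theorem wordGcd_dvd {l : List (ℕ × ℕ)} {p : ℕ × ℕ} (hp : p ∈ l) : wordGcd l ∣ p.1 := by
  induction l with
  | nil => simp at hp
  | cons q l ih =>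
    rw [wordGcd_cons]
    rcases List.mem_cons.1 hp with rfl | h
    · exact Nat.gcd_dvd_left _ _
    · exact (Nat.gcd_dvd_right _ _).trans (ih h)

theorem wordSum_map_mul (g : ℕ) (l : List (ℕ × ℕ)) :
    wordSum (l.map fun p => (g * p.1, p.2)) = g * wordSum l := by
  induction l with
  | nil => simp [wordSum]
  | cons p l ih => rw [List.map_cons, wordSum_cons, wordSum_cons, ih]; ring

theorem dSeq_le_cSeq (n : ℕ) : dSeq n ≤ cSeq n :=
  Set.ncard_le_ncard (fun _ h => h.1) (genCompositions_finite n)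

/-- A word which is not primitive arises from a shorter one by multiplying all `v i` by its
greatest common divisor. -/
theorem cSeq_le_dSeq_add_sum {n : ℕ} (hn : 0 < n) :
    cSeq n ≤ dSeq n + ∑ g ∈ Icc 2 n, cSeq (n / g) := by
  let φ : ℕ → List (ℕ × ℕ) → List (ℕ × ℕ) := fun g => List.map fun p => (g * p.1, p.2)
  have hsub : genCompositions n ⊆
      primGenCompositions n ∪ ⋃ g ∈ Icc 2 n, φ g '' genCompositions (n / g) := by
    intro l hl
    by_cases h1 : wordGcd l = 1
    · exact Or.inl ⟨hl, h1⟩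
    right
    obtain ⟨hpos, hsum⟩ := hl
    have hlift : φ (wordGcd l) (l.map fun p => (p.1 / wordGcd l, p.2)) = l := by
      simp only [φ, List.map_map]
      conv_rhs => rw [← List.map_id l]
      exact List.map_congr_left fun p hp => by
        simp [Nat.mul_div_cancel' (wordGcd_dvd hp)]
    have hws : wordGcd l * wordSum (l.map fun p => (p.1 / wordGcd l, p.2)) = n := by
      rw [← wordSum_map_mul]
      exact (congrArg wordSum hlift).trans hsum
    -- The empty word has gcd 0; n > 0 excludes this value.
    have hg0 : 0 < wordGcd l := Nat.pos_of_ne_zero fun h => by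
      rw [h, zero_mul] at hws
      omega
    simp only [Set.mem_iUnion, exists_prop]
    refine ⟨wordGcd l, mem_Icc.2 ⟨by omega, Nat.le_of_dvd hn ⟨_, hws.symm⟩⟩, _, ⟨?_, ?_⟩, hlift⟩
    · intro p hp
      obtain ⟨q, hq, rfl⟩ := List.mem_map.1 hp
      exact ⟨Nat.div_pos (Nat.le_of_dvd (hpos q hq).1 (wordGcd_dvd hq)) hg0, (hpos q hq).2⟩
    · exact (Nat.div_eq_of_eq_mul_right hg0 hws.symm).symm
  have hfin : ∀ g, (φ g '' genCompositions (n / g)).Finite := fun g =>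
    (genCompositions_finite _).image _
  have hU : (⋃ g ∈ Icc 2 n, φ g '' genCompositions (n / g)).Finite :=
    (Icc 2 n).finite_toSet.biUnion fun g _ => hfin g
  calc cSeq n ≤ _ := Set.ncard_le_ncard hsub
        (((genCompositions_finite n).subset fun _ h => h.1).union hU)
    _ ≤ _ := Set.ncard_union_le _ _
    _ ≤ _ := by
      refine Nat.add_le_add_left ((Finset.set_ncard_biUnion_le _ _).trans ?_) _
      exact sum_le_sum fun g _ => Set.ncard_image_le (genCompositions_finite _)

/-! ### The Lambert series and its derivative -/

/-- The bound τ(n) ≤ n suffices. The case a = 0 serves the series itself, a = 1 its derivative and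
the mean. -/
theorem summable_pow_mul_card_divisors_mul_pow (a : ℕ) {z : ℝ} (hz : |z| < 1) :
    Summable fun n : ℕ => (n : ℝ) ^ a * (n.divisors.card * z ^ n) := by
  refine Summable.of_norm_bounded
    (summable_pow_mul_geometric_of_norm_lt_one (a + 1) (r := |z|) (by simpa using hz)) fun n => ?_
  rw [norm_mul, norm_mul, norm_pow, norm_pow, Real.norm_natCast, Real.norm_natCast,
    Real.norm_eq_abs, pow_succ, mul_assoc]
  gcongr
  exact Nat.card_divisors_le_self n

theorem lambertSigma_eq_tsum {z : ℝ} (hz : |z| < 1) :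
    lambertSigma z = ∑' n : ℕ, (n.divisors.card : ℝ) * z ^ n := by
  have h := tsum_pow_div_one_sub_eq_tsum_sigma (𝕜 := ℝ) (r := z) (by simpa using hz) 0
  simp only [pow_zero, one_mul, ArithmeticFunction.sigma_zero_apply] at h
  have hsum : Summable fun n : ℕ => (n.divisors.card : ℝ) * z ^ n := by
    simpa using summable_pow_mul_card_divisors_mul_pow 0 hz
  rw [tsum_pnat_eq_tsum_succ (f := fun n : ℕ => z ^ n / (1 - z ^ n)),
    tsum_pnat_eq_tsum_succ (f := fun n : ℕ => (n.divisors.card : ℝ) * z ^ n)] at h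
  rw [lambertSigma, h, hsum.tsum_eq_zero_add]
  simp

theorem hasSum_lambertSigma {z : ℝ} (hz : |z| < 1) :
    HasSum (fun n : ℕ => (n.divisors.card : ℝ) * z ^ n) (lambertSigma z) := by
  rw [lambertSigma_eq_tsum hz]
  simpa using (summable_pow_mul_card_divisors_mul_pow 0 hz).hasSum

theorem hasDerivAt_lambertSigma {z : ℝ} (hz : |z| < 1) :
    HasDerivAt lambertSigma (∑' n : ℕ, (n.divisors.card : ℝ) * (n * z ^ (n - 1))) z := by
  -- Termwise differentiation needs a summable bound uniform near z; the terms at r > |z| provide it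
  -- on (-r, r).
  obtain ⟨r, hzr, hr⟩ := exists_between hz
  have hr0 : 0 < r := (abs_nonneg z).trans_lt hzr
  have hu : Summable fun n : ℕ => (n.divisors.card : ℝ) * (n * r ^ (n - 1)) := by
    refine ((summable_pow_mul_card_divisors_mul_pow 1 (z := r)
      (by rwa [abs_of_pos hr0])).mul_left r⁻¹).congr fun n => ?_
    rcases n with _ | n
    · simp
    · rw [Nat.add_sub_cancel]
      field_simp
      ring
  have h := hasDerivAt_tsum_of_isPreconnected (t := Set.Ioo (-r) r) (y₀ := 0) (y := z)
    (g := fun (n : ℕ) (x : ℝ) => (n.divisors.card : ℝ) * x ^ n) hu isOpen_Ioo isPreconnected_Ioo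
    (fun n y _ => (hasDerivAt_pow n y).const_mul _)
    (fun n y hy => by
      have : |y| ≤ r := (abs_lt.2 hy).le
      rw [norm_mul, norm_mul, norm_pow, Real.norm_natCast, Real.norm_natCast, Real.norm_eq_abs]
      gcongr)
    ⟨by linarith, hr0⟩ (hasSum_lambertSigma (by simp)).summable (abs_lt.1 hzr)
  refine h.congr_of_eventuallyEq ?_
  filter_upwards [(continuous_abs.tendsto z).eventually_lt_const hz] with x hx
  exact lambertSigma_eq_tsum hx

/-- This identifies the mean of the step distribution. -/
theorem mul_deriv_lambertSigma {z : ℝ} (hz : |z| < 1) :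
    z * deriv lambertSigma z = ∑' n : ℕ, (n : ℝ) * (n.divisors.card * z ^ n) := by
  rw [(hasDerivAt_lambertSigma hz).deriv, ← tsum_mul_left]
  refine tsum_congr fun n => ?_
  rcases n with _ | n
  · simp
  · rw [Nat.add_sub_cancel]
    ring

theorem lambertSigma_strictMonoOn : StrictMonoOn lambertSigma (Set.Ico 0 1) := by
  intro x hx y hy hxy
  have hx' := hasSum_lambertSigma (abs_lt.2 ⟨by linarith [hx.1], hx.2⟩)
  have hy' := hasSum_lambertSigma (abs_lt.2 ⟨by linarith [hy.1], hy.2⟩)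
  refine hasSum_lt (i := 1) (fun n => ?_) ?_ hx' hy'
  · have := hx.1
    gcongr
  · simpa using hxy

/-! ### Locating the root -/

theorem summable_lambert {z : ℝ} (h0 : 0 ≤ z) (h1 : z < 1) :
    Summable fun n : ℕ => z ^ (n + 1) / (1 - z ^ (n + 1)) := by
  refine Summable.of_nonneg_of_le (fun n => ?_) (fun n => ?_)
    (((summable_nat_add_iff 1).2 (summable_geometric_of_lt_one h0 h1)).div_const (1 - z))
  · exact div_nonneg (by positivity) (sub_nonneg.2 (pow_le_one₀ h0 h1.le))
  · have : z ^ (n + 1) ≤ z := pow_le_of_le_one h0 h1.le n.succ_ne_zero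
    exact div_le_div_of_nonneg_left (by positivity) (by linarith) (by linarith)

theorem sum_range_le_lambertSigma {z : ℝ} (h0 : 0 ≤ z) (h1 : z < 1) (N : ℕ) :
    ∑ n ∈ range N, z ^ (n + 1) / (1 - z ^ (n + 1)) ≤ lambertSigma z :=
  (summable_lambert h0 h1).sum_le_tsum _ fun n _ =>
    div_nonneg (by positivity) (sub_nonneg.2 (pow_le_one₀ h0 h1.le))

/-- In the tail each denominator is at least 1 - z, which leaves a geometric series. -/
theorem lambertSigma_le_sum_range_add {z : ℝ} (h0 : 0 ≤ z) (h1 : z < 1) (N : ℕ) :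
    lambertSigma z ≤
      ∑ n ∈ range N, z ^ (n + 1) / (1 - z ^ (n + 1)) + z ^ (N + 1) / (1 - z) ^ 2 := by
  have hs := summable_lambert h0 h1
  rw [lambertSigma, ← hs.sum_add_tsum_nat_add N]
  gcongr
  have hg : HasSum (fun n : ℕ => z ^ (N + 1) / (1 - z) * z ^ n) (z ^ (N + 1) / (1 - z) ^ 2) := by
    convert! (hasSum_geometric_of_lt_one h0 h1).mul_left (z ^ (N + 1) / (1 - z)) using 1
    rw [pow_two, ← div_div, div_eq_mul_inv _ (1 - z), div_eq_mul_inv _ (1 - z)]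
  refine hasSum_le (fun n => ?_) ((summable_nat_add_iff N).2 hs).hasSum hg
  have : z ^ (n + N + 1) ≤ z := pow_le_of_le_one h0 h1.le (Nat.succ_ne_zero _)
  calc z ^ (n + N + 1) / (1 - z ^ (n + N + 1)) ≤ z ^ (n + N + 1) / (1 - z) :=
        div_le_div_of_nonneg_left (by positivity) (by linarith) (by linarith)
    _ = z ^ (N + 1) / (1 - z) * z ^ n := by ring

/-- The endpoints are 0.406 ± 0.0005. With nine terms the tail bound is below 0.0004, less than the
gap to 1. -/
theorem lambertSigma_lower_endpoint : lambertSigma 0.4055 < 1 := by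
  refine (lambertSigma_le_sum_range_add (by norm_num) (by norm_num) 9).trans_lt ?_
  norm_num [sum_range_succ]

theorem lambertSigma_upper_endpoint : 1 < lambertSigma 0.4065 := by
  refine lt_of_lt_of_le ?_ (sum_range_le_lambertSigma (by norm_num) (by norm_num) 9)
  norm_num [sum_range_succ]

/-- Division by zero makes every term 0, so the endpoint 1 is not a spurious root. -/
theorem lambertSigma_one : lambertSigma 1 = 0 := by
  simp [lambertSigma]

theorem existsUnique_lambertSigma_eq_one :
    ∃! ρ : ℝ, ρ ∈ Set.Icc (0 : ℝ) 1 ∧ lambertSigma ρ = 1 := by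
  have hlt : ∀ x ∈ Set.Icc (0 : ℝ) 1, lambertSigma x = 1 → x ∈ Set.Ico (0 : ℝ) 1 := by
    intro x hx h
    refine ⟨hx.1, lt_of_le_of_ne hx.2 ?_⟩
    rintro rfl
    simp [lambertSigma_one] at h
  have hc : ContinuousOn lambertSigma (Set.Icc 0.4055 0.4065) := fun x hx =>
    (hasDerivAt_lambertSigma (abs_lt.2
      ⟨by linarith [hx.1], by linarith [hx.2]⟩)).continuousAt.continuousWithinAt
  obtain ⟨ρ, hρ, h⟩ := intermediate_value_Icc (by norm_num) hc
    ⟨lambertSigma_lower_endpoint.le, lambertSigma_upper_endpoint.le⟩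
  have hI : ρ ∈ Set.Icc (0 : ℝ) 1 := ⟨by linarith [hρ.1], by linarith [hρ.2]⟩
  exact ⟨ρ, ⟨hI, h⟩, fun x hx => lambertSigma_strictMonoOn.injOn (hlt x hx.1 hx.2) (hlt ρ hI h)
    (hx.2.trans h.symm)⟩

theorem lambertSigma_root_bounds {ρ : ℝ} (hρ : ρ ∈ Set.Icc (0 : ℝ) 1) (h : lambertSigma ρ = 1) :
    0.4055 < ρ ∧ ρ < 0.4065 := by
  have hρ1 : ρ < 1 := lt_of_le_of_ne hρ.2 (by
    rintro rfl
    simp [lambertSigma_one] at h)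
  constructor
  · refine (lambertSigma_strictMonoOn.lt_iff_lt ⟨by norm_num, by norm_num⟩ ⟨hρ.1, hρ1⟩).1 ?_
    rw [h]
    exact lambertSigma_lower_endpoint
  · refine (lambertSigma_strictMonoOn.lt_iff_lt ⟨hρ.1, hρ1⟩ ⟨by norm_num, by norm_num⟩).1 ?_
    rw [h]
    exact lambertSigma_upper_endpoint

/-! ### Asymptotics of the two counts -/

section Asymptotics

variable {ρ : ℝ}

theorem cSeq_mul_pow_eq_sum (n : ℕ) (hn : 0 < n) :
    (cSeq n : ℝ) * ρ ^ n =
      ∑ q ∈ antidiagonal n, ((q.1.divisors.card : ℝ) * ρ ^ q.1) * (cSeq q.2 * ρ ^ q.2) := by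
  rw [cSeq_eq_sum_antidiagonal hn, Nat.cast_sum, sum_mul]
  refine sum_congr rfl fun q hq => ?_
  rw [← HasAntidiagonal.mem_antidiagonal.1 hq, pow_add]
  push_cast
  ring

theorem card_divisors_mul_pow_pos (h0 : 0 < ρ) (k : ℕ) (hk : 0 < k) :
    0 < (k.divisors.card : ℝ) * ρ ^ k :=
  mul_pos (Nat.cast_pos.2 (card_pos.2 (Nat.nonempty_divisors.2 hk.ne'))) (pow_pos h0 k)

theorem cSeq_mul_pow_le_one (h0 : 0 < ρ) (h1 : ρ < 1) (h : lambertSigma ρ = 1) (n : ℕ) :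
    (cSeq n : ℝ) * ρ ^ n ≤ 1 :=
  renewal_le_one (p := fun k => (k.divisors.card : ℝ) * ρ ^ k) (by simp)
    (card_divisors_mul_pow_pos h0)
    (h ▸ hasSum_lambertSigma (abs_lt.2 ⟨by linarith, h1⟩)) (by simp [cSeq_zero])
    cSeq_mul_pow_eq_sum n

theorem tendsto_cSeq_mul_pow (h0 : 0 < ρ) (h1 : ρ < 1) (h : lambertSigma ρ = 1) :
    Tendsto (fun n => (cSeq n : ℝ) * ρ ^ n) atTop (𝓝 (1 / (ρ * deriv lambertSigma ρ))) := by
  have hρ : |ρ| < 1 := abs_lt.2 ⟨by linarith, h1⟩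
  rw [mul_deriv_lambertSigma hρ]
  exact renewal_tendsto (p := fun k => (k.divisors.card : ℝ) * ρ ^ k) (by simp)
    (card_divisors_mul_pow_pos h0) (h ▸ hasSum_lambertSigma hρ) (by simp [cSeq_zero])
    cSeq_mul_pow_eq_sum (by simpa using summable_pow_mul_card_divisors_mul_pow 1 hρ)

theorem cSeq_sub_dSeq_mul_pow_le (h0 : 0 < ρ) (h1 : ρ < 1) (h : lambertSigma ρ = 1)
    {n : ℕ} (hn : 0 < n) :
    ((cSeq n : ℝ) - dSeq n) * ρ ^ n ≤ n * √ρ ^ n := by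
  have hterm : ∀ g ∈ Icc 2 n, (cSeq (n / g) : ℝ) * ρ ^ n ≤ √ρ ^ n := by
    intro g hg
    have hm : n / g ≤ n / 2 := Nat.div_le_div_left (mem_Icc.1 hg).1 two_pos
    calc (cSeq (n / g) : ℝ) * ρ ^ n
        = (cSeq (n / g) * ρ ^ (n / g)) * ρ ^ (n - n / g) := by
          rw [mul_assoc, ← pow_add, Nat.add_sub_cancel' (Nat.div_le_self n g)]
      _ ≤ ρ ^ (n - n / g) :=
          mul_le_of_le_one_left (by positivity) (cSeq_mul_pow_le_one h0 h1 h _)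
      -- Passing to √ρ keeps the exponents natural for odd n: g ≥ 2 gives 2 * (n - n / g) ≥ n.
      _ = √ρ ^ (2 * (n - n / g)) := by rw [pow_mul, Real.sq_sqrt h0.le]
      _ ≤ √ρ ^ n := pow_le_pow_of_le_one (Real.sqrt_nonneg _)
          (Real.sqrt_le_one.2 h1.le) (by omega)
  have hcd : (cSeq n : ℝ) - dSeq n ≤ ∑ g ∈ Icc 2 n, (cSeq (n / g) : ℝ) := by
    rw [sub_le_iff_le_add']
    exact_mod_cast cSeq_le_dSeq_add_sum hn
  calc ((cSeq n : ℝ) - dSeq n) * ρ ^ n ≤ (∑ g ∈ Icc 2 n, (cSeq (n / g) : ℝ)) * ρ ^ n := by gcongr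
    _ ≤ (Icc 2 n).card • √ρ ^ n := by
      rw [sum_mul]
      exact sum_le_card_nsmul _ _ _ hterm
    _ ≤ n * √ρ ^ n := by
      rw [nsmul_eq_mul]
      gcongr
      rw [Nat.card_Icc]
      omega

theorem tendsto_dSeq_mul_pow (h0 : 0 < ρ) (h1 : ρ < 1) (h : lambertSigma ρ = 1) :
    Tendsto (fun n => (dSeq n : ℝ) * ρ ^ n) atTop (𝓝 (1 / (ρ * deriv lambertSigma ρ))) := by
  have hz : Tendsto (fun n => ((cSeq n : ℝ) - dSeq n) * ρ ^ n) atTop (𝓝 0) := by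
    refine tendsto_of_tendsto_of_tendsto_of_le_of_le' tendsto_const_nhds
      (tendsto_self_mul_const_pow_of_lt_one (Real.sqrt_nonneg ρ)
        ((Real.sqrt_lt' one_pos).2 (by simpa using h1))) ?_ ?_
    · exact .of_forall fun n => mul_nonneg
        (sub_nonneg.2 (by exact_mod_cast dSeq_le_cSeq n)) (by positivity)
    · filter_upwards [eventually_gt_atTop 0] with n hn
      exact cSeq_sub_dSeq_mul_pow_le h0 h1 h hn
  have := (tendsto_cSeq_mul_pow h0 h1 h).sub hz
  rw [sub_zero] at this
  exact this.congr fun n => by ring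

theorem mul_deriv_lambertSigma_pos (h0 : 0 < ρ) (h1 : ρ < 1) :
    0 < ρ * deriv lambertSigma ρ := by
  have hρ : |ρ| < 1 := abs_lt.2 ⟨by linarith, h1⟩
  rw [mul_deriv_lambertSigma hρ]
  have hs : Summable fun n : ℕ => (n : ℝ) * (n.divisors.card * ρ ^ n) := by
    simpa using summable_pow_mul_card_divisors_mul_pow 1 hρ
  exact hs.tsum_pos (fun n => by positivity) 1 (by simpa using h0)

end Asymptotics

theorem tendsto_div_const_mul_zpow_neg {a : ℕ → ℝ} {ρ M : ℝ} (hM : M ≠ 0)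
    (ha : Tendsto (fun n => a n * ρ ^ n) atTop (𝓝 (1 / M))) :
    Tendsto (fun n : ℕ => a n / (1 / M * ρ ^ (-(n : ℤ)))) atTop (𝓝 1) := by
  have := ha.mul_const M
  rw [one_div_mul_cancel hM] at this
  refine this.congr fun n => ?_
  rw [zpow_neg, zpow_natCast, div_eq_mul_inv, mul_inv, inv_inv, one_div, inv_inv]
  ring

theorem mainTheorem6 :
    (∃! ρ : ℝ, ρ ∈ Set.Icc (0 : ℝ) 1 ∧ lambertSigma ρ = 1) ∧
    ∀ ρ : ℝ, ρ ∈ Set.Icc (0 : ℝ) 1 → lambertSigma ρ = 1 →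
      |ρ - 0.406| < 0.0005 ∧
      DifferentiableAt ℝ lambertSigma ρ ∧
      Filter.Tendsto
        (fun n : ℕ => (dSeq n : ℝ) / (1 / (ρ * deriv lambertSigma ρ) * ρ ^ (-(n : ℤ))))
        Filter.atTop (nhds 1) ∧
      Filter.Tendsto
        (fun n : ℕ => (cSeq n : ℝ) / (1 / (ρ * deriv lambertSigma ρ) * ρ ^ (-(n : ℤ))))
        Filter.atTop (nhds 1) ∧
      Filter.Tendsto (fun n : ℕ => (dSeq n : ℝ) / (cSeq n : ℝ)) Filter.atTop (nhds 1) := by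
  refine ⟨existsUnique_lambertSigma_eq_one, fun ρ hρ h => ?_⟩
  obtain ⟨hl, hu⟩ := lambertSigma_root_bounds hρ h
  have h0 : 0 < ρ := by linarith
  have h1 : ρ < 1 := by linarith
  have hM := (mul_deriv_lambertSigma_pos h0 h1).ne'
  have hc := tendsto_cSeq_mul_pow h0 h1 h
  have hd := tendsto_dSeq_mul_pow h0 h1 h
  refine ⟨abs_lt.2 ⟨by linarith, by linarith⟩,
    (hasDerivAt_lambertSigma (abs_lt.2 ⟨by linarith, h1⟩)).differentiableAt,
    tendsto_div_const_mul_zpow_neg hM hd, tendsto_div_const_mul_zpow_neg hM hc, ?_⟩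
  have hdc := hd.div hc (one_div_ne_zero hM)
  rw [div_self (one_div_ne_zero hM)] at hdc
  exact hdc.congr fun n => mul_div_mul_right _ _ (pow_pos h0 n).ne'
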